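/- **Definitions.** A graphon is a bounded symmetric measurable function $W:[0,1]^2\to\mathbb R$ (any repetition of eigenvalues is allowed); a graphon signal is a pair $(W,\phi)$ with $\phi\in L^2([0,1])$; $(T_Wf)(u)=\int_0^1 W(u,v)f(v)\,dv$ on $L^2([0,1])$. A graph signal $(G_n,x_n)$ is an undirected weighted graph on $n$ nodes with real symmetric shift operator $S_n\in\mathbb R^{n\times n}$, together with $x_n\in\mathbb R^n$. With $I_j=[\tfrac{j-1}{n},\tfrac jn)$ for $1\le j\le n-1$ and $I_n=[\tfrac{n-1}{n},1]$, it induces the graphon signal $W_{G_n}(u,v)=\sum_{j,k}[S_n]_{jk}\mathbf 1(u\in I_j)\mathbf 1(v\in I_k)$, $\phi_{G_n}(u)=\sum_j [x_n]_j\mathbf 1(u\in I_j)$. We say that $(G_n,x_n)$ converges to $(W,\phi)$ if there are permutations $\pi_n$ of the nodes such that $$\|W_{\pi_n(G_n)}-W\|_\square\to 0\quad\text{and}\quad \|\phi_{\pi_n(G_n)}-\phi\|_{L^2}\to0,$$ where $(W_{\pi_n(G_n)},\phi_{\pi_n(G_n)})$ is induced by the relabeled graph signal $(\pi_n(G_n),\pi_n(x_n))$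 and $\|U\|_\square=\sup_{A,C\subseteq[0,1]\text{ measurable}}\left|\int_{A\times C}U\right|$ is the cut norm. **Theorem.** Let $B\in\mathbb R$, let $(W,\phi)$ be a graphon signal with $|W|\le B$, and let $(G_n,x_n)$ be graph signals with edge weights $|[S_n]_{jk}|\le B$ for all $n,j,k$ (for graphons and weights with values in $[0,1]$, take $B=1$). Let $h$ be a real function with $|h(\lambda)-h(\lambda')|\le L|\lambda-\lambda'|$ for all $\lambda,\lambda'\in[-B,B]$. Let $S_n=V_n\Lambda(S_n)V_n^{\mathsf H}$ be any eigendecomposition with $V_n$ real orthogonal and $\Lambda(S_n)$ diagonal, and put $y_n=V_n\,h(\Lambda(S_n)/n)\,V_n^{\mathsf H}x_n$. Let $(\varphi_i)_i$ be any orthonormal basis of $L^2([0,1])$ of eigenfunctions of $T_W$, $T_W\varphi_i=\lambda_i\varphi_i$ (eigenvalues repeated with multiplicity, $\lambda_i=0$ included when $T_W$ has a kernel), and let $\hat\phi(\lambda_i)=\int_0^1\phi\,\varphi_i$. If $(G_n,x_n)$ converges to $(W,\phi)$, then the series $$\gamma=\sum_i h(\lambda_i)\,\hat\phi(\lambda_i)\,\varphi_i$$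 converges unconditionally in $L^2([0,1])$, and the graph signals $(G_n,y_n)$ converge to the graphon signal $(W,\gamma)$. -/

import Mathlib

open MeasureTheory Filter Topology
open scoped ENNReal NNReal

noncomputable section

namespace GraphonSP

/-- The unit interval `[0,1]`; it carries Lebesgue measure, a probability measure. -/
abbrev I : Type := ↥unitInterval

/-- The real Hilbert space `L²([0,1])`. -/
abbrev L2 : Type := Lp ℝ 2 (volume : Measure I)

/-- A graphon with values in `[-B, B]`: a symmetric measurable function on `[0,1]²` that is
bounded by `B`. Graphons with values in `[0,1]` are covered by `B = 1`. -/
structure IsGraphon (B : ℝ) (W : I → I → ℝ) : Prop where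
  measurable : Measurable (Function.uncurry W)
  symm : ∀ u v, W u v = W v u
  bound : ∀ u v, |W u v| ≤ B

/-- The shift operator (weighted adjacency matrix) of an undirected graph on `n` nodes whose
edge weights are bounded by `B` in absolute value. -/
structure IsGraphShift (B : ℝ) {n : ℕ} (S : Matrix (Fin n) (Fin n) ℝ) : Prop where
  symm : S.IsSymm
  bound : ∀ i j, |S i j| ≤ B

/-- The partition of `[0,1]` into `n` intervals of length `1/n`: with 0-based indices,
`[j/n, (j+1)/n)` for `j + 1 < n`, and the closed interval `[(n-1)/n, 1]` for the last one. -/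
def cell (n : ℕ) (j : Fin n) : Set I :=
  {u | (j : ℝ) / n ≤ (u : ℝ) ∧ ((u : ℝ) < ((j : ℝ) + 1) / n ∨ (j : ℕ) + 1 = n)}

open Classical in
/-- The graphon induced by a graph:
`W_G(u,v) = ∑ j, ∑ k, S j k * 𝟙(u ∈ I_j) * 𝟙(v ∈ I_k)`. -/
def inducedGraphon {n : ℕ} (S : Matrix (Fin n) (Fin n) ℝ) (u v : I) : ℝ :=
  ∑ j, ∑ k, S j k * (if u ∈ cell n j then 1 else 0) * (if v ∈ cell n k then 1 else 0)

open Classical in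
/-- The graphon signal induced by a graph signal: `φ_G(u) = ∑ j, x j * 𝟙(u ∈ I_j)`. -/
def inducedSignal {n : ℕ} (x : Fin n → ℝ) (u : I) : ℝ :=
  ∑ j, x j * (if u ∈ cell n j then 1 else 0)

/-- The cut norm `sup_{A, C} |∫_{A × C} U|`, over measurable `A, C ⊆ [0,1]`. -/
def cutNorm (U : I → I → ℝ) : ℝ≥0∞ :=
  ⨆ (A : Set I) (C : Set I) (_ : MeasurableSet A) (_ : MeasurableSet C),
    ‖∫ p in A ×ˢ C, U p.1 p.2 ∂((volume : Measure I).prod (volume : Measure I))‖ₑ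

/-- Convergence of a sequence of graph signals `(G_n, x_n)`, with `G_n` a graph on `n` nodes
with shift operator `S n`, to the graphon signal `(W, φ)`: after suitable relabelings `π n` of the
nodes, applied to the graph and the signal together, the induced graphons converge to `W` in cut
norm and the induced graphon signals converge to `φ` in `L²`. -/
def GraphSignalConverges (S : ∀ n : ℕ, Matrix (Fin n) (Fin n) ℝ) (x : ∀ n : ℕ, Fin n → ℝ)
    (W : I → I → ℝ) (φ : L2) : Prop :=
  ∃ π : ∀ n : ℕ, Equiv.Perm (Fin n),
    Tendsto (fun n => cutNorm fun u v =>
      inducedGraphon ((S n).submatrix (π n) (π n)) u v - W u v) atTop (𝓝 0) ∧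
    Tendsto (fun n => eLpNorm (fun u => inducedSignal (x n ∘ π n) u - φ u) 2
      (volume : Measure I)) atTop (𝓝 0)

/-- `S = V Λ Vᵀ` with `V` orthogonal (the eigenvectors) and `Λ` diagonal (the eigenvalues). -/
def IsEigendecomposition {n : ℕ} (S V : Matrix (Fin n) (Fin n) ℝ) (lam : Fin n → ℝ) : Prop :=
  V ∈ Matrix.orthogonalGroup (Fin n) ℝ ∧ S = V * Matrix.diagonal lam * V.transpose

/-- The graph filter `H(S) = V h(Λ/n) Vᵀ`. -/
def graphFilter (h : ℝ → ℝ) {n : ℕ} (V : Matrix (Fin n) (Fin n) ℝ) (lam : Fin n → ℝ) :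
    Matrix (Fin n) (Fin n) ℝ :=
  V * Matrix.diagonal (fun i => h (lam i / n)) * V.transpose

/-- The complete orthonormal system `b` of `L²([0,1])` consists of eigenfunctions of the operator
`(T_W f)(u) = ∫ W(u,v) f(v) dv`, with eigenvalues `ev` (repeated with multiplicity, and including
the eigenvalue `0` when `T_W` has a kernel). -/
def IsGraphonEigenbasis (W : I → I → ℝ) {ι : Type*} (b : HilbertBasis ι ℝ L2) (ev : ι → ℝ) :
    Prop :=
  ∀ i, ∀ᵐ u ∂(volume : Measure I), ∫ v, W u v * b i v = ev i * b i u

/-- The term `h(λ_i) φ̂(λ_i) φ_i` of the graphon filter output, where `φ̂(λ_i) = ⟨φ_i, φ⟩`. -/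
def graphonFilterTerm (h : ℝ → ℝ) {ι : Type*} (b : HilbertBasis ι ℝ L2) (ev : ι → ℝ) (φ : L2)
    (i : ι) : L2 :=
  (h (ev i) * inner ℝ (b i) φ) • b i

/-- The graphon filter output `T_H φ = ∑ i, h(λ_i) φ̂(λ_i) φ_i`, as a sum in `L²([0,1])`. -/
def graphonFilter (h : ℝ → ℝ) {ι : Type*} (b : HilbertBasis ι ℝ L2) (ev : ι → ℝ) (φ : L2) : L2 :=
  ∑' i, graphonFilterTerm h b ev φ i

end GraphonSP

end

/-!
The filters are functions of operators, so they are approximated uniformly by polynomials in the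
shift, for which strong convergence of the operators is enough; individual eigenvalues and
eigenvectors are never compared.

Let `T_n` be the integral operators of the induced graphons. They are bounded by `B` on `L²`, and
cut norm convergence gives `T_n f → T_W f` for every `f` in `L²` (`tendsto_kernelOp_apply`): on an
indicator function the `L¹` norm of the difference is at most twice the cut norm, the difference is
bounded by `2B`, so its `L²` norm tends to `0`; simple functions are dense and the `T_n` are
uniformly bounded. On step functions `T_n` acts as the matrix `S_n / n` (`kernelOp_inducedL2`).
Hence a polynomial filter, which is obtained from constants by sums and multiplication by the
shift, has converging outputs (`tendsto_inducedL2_polynomial`).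

All `λ_i(S_n) / n` and all eigenvalues of `T_W` lie in `[-B, B]`, and filtering by `r` has operator
norm at most `sup |r|` over `[-B, B]`, for graphs by orthogonality of `V_n` and for the graphon by
orthonormality of the basis. Weierstrass approximation of `h` then finishes the proof
(`tendsto_inducedL2_graphFilter`). Relabeling the nodes of `(S_n, x_n)` relabels the rows of `V_n`,
so the permutations that work for the inputs work for the outputs.
-/

namespace GraphonSP

/-! ### The integral operator of a bounded kernel -/

lemma integral_norm_le_norm (f : L2) : ∫ v, ‖f v‖ ≤ ‖f‖ := by
  rw [integral_norm_eq_lintegral_enorm (Lp.aestronglyMeasurable f), Lp.norm_def,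
    ← eLpNorm_one_eq_lintegral_enorm]
  exact ENNReal.toReal_mono (Lp.eLpNorm_ne_top f)
    (eLpNorm_le_eLpNorm_of_exponent_le (by norm_num) (Lp.aestronglyMeasurable f))

lemma norm_sq_eq_integral (f : L2) : ‖f‖ ^ 2 = ∫ u, f u ^ 2 := by
  rw [← real_inner_self_eq_norm_sq, L2.inner_def]
  simp [pow_two]

lemma integrable_coe (f : L2) : Integrable (fun v => f v) :=
  (Lp.memLp f).integrable (by norm_num)

lemma IsGraphon.nonneg {B : ℝ} {W : I → I → ℝ} (hW : IsGraphon B W) : 0 ≤ B :=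
  (abs_nonneg _).trans (hW.bound 0 0)

lemma IsGraphon.integrable_mul {B : ℝ} {W : I → I → ℝ} (hW : IsGraphon B W) (f : L2) (u : I) :
    Integrable (fun v => W u v * f v) :=
  (integrable_coe f).bdd_mul (c := B) hW.measurable.of_uncurry_left.aestronglyMeasurable
    (ae_of_all _ fun v => hW.bound u v)

lemma IsGraphon.abs_integral_le {B : ℝ} {W : I → I → ℝ} (hW : IsGraphon B W) (f : L2) (u : I) :
    |∫ v, W u v * f v| ≤ B * ‖f‖ :=
  calc |∫ v, W u v * f v| ≤ ∫ v, ‖W u v * f v‖ :=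
        norm_integral_le_integral_norm (fun v => W u v * f v)
    _ ≤ ∫ v, B * ‖f v‖ := by
        refine integral_mono (hW.integrable_mul f u).norm ((integrable_coe f).norm.const_mul B) ?_
        intro v
        simp only [norm_mul]
        exact mul_le_mul_of_nonneg_right (hW.bound u v) (norm_nonneg _)
    _ = B * ∫ v, ‖f v‖ := integral_const_mul _ _
    _ ≤ B * ‖f‖ := mul_le_mul_of_nonneg_left (integral_norm_le_norm f) hW.nonneg

lemma IsGraphon.memLp_integral {B : ℝ} {W : I → I → ℝ} (hW : IsGraphon B W) (f : L2) :
    MemLp (fun u => ∫ v, W u v * f v) 2 (volume : Measure I) := by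
  refine MemLp.of_bound ?_ (B * ‖f‖) (ae_of_all _ fun u => hW.abs_integral_le f u)
  refine AEStronglyMeasurable.integral_prod_right' (f := fun p : I × I => W p.1 p.2 * f p.2) ?_
  exact hW.measurable.aestronglyMeasurable.mul (Lp.aestronglyMeasurable f).comp_snd

/-- The operator `(T_W f)(u) = ∫ W(u,v) f(v) dv` on `L²([0,1])`. -/
noncomputable def kernelOp {B : ℝ} {W : I → I → ℝ} (hW : IsGraphon B W) : L2 →L[ℝ] L2 :=
  LinearMap.mkContinuous
    { toFun := fun f => (hW.memLp_integral f).toLp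
      map_add' := fun f g => by
        rw [← MemLp.toLp_add]
        refine MemLp.toLp_congr _ _ (ae_of_all _ fun u => ?_)
        simp only [Pi.add_apply]
        rw [← integral_add (hW.integrable_mul f u) (hW.integrable_mul g u)]
        refine integral_congr_ae ?_
        filter_upwards [Lp.coeFn_add f g] with v hv
        rw [hv, Pi.add_apply, mul_add]
      map_smul' := fun c f => by
        rw [RingHom.id_apply, ← MemLp.toLp_const_smul]
        refine MemLp.toLp_congr _ _ (ae_of_all _ fun u => ?_)
        simp only [Pi.smul_apply, smul_eq_mul]
        rw [← integral_const_mul]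
        refine integral_congr_ae ?_
        filter_upwards [Lp.coeFn_smul c f] with v hv
        rw [hv, Pi.smul_apply, smul_eq_mul, mul_left_comm] }
    B (fun f => by
      refine (Lp.norm_le_of_ae_bound (C := B * ‖f‖)
        (mul_nonneg hW.nonneg (norm_nonneg _)) ?_).trans (by simp [measureUnivNNReal])
      filter_upwards [(hW.memLp_integral f).coeFn_toLp] with u hu
      exact (congrArg norm hu).trans_le (hW.abs_integral_le f u))

lemma kernelOp_ae {B : ℝ} {W : I → I → ℝ} (hW : IsGraphon B W) (f : L2) :
    kernelOp hW f =ᵐ[volume] fun u => ∫ v, W u v * f v :=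
  (hW.memLp_integral f).coeFn_toLp

lemma norm_kernelOp_le {B : ℝ} {W : I → I → ℝ} (hW : IsGraphon B W) : ‖kernelOp hW‖ ≤ B :=
  LinearMap.mkContinuous_norm_le _ hW.nonneg _

lemma IsGraphonEigenbasis.kernelOp_apply {B : ℝ} {W : I → I → ℝ} (hW : IsGraphon B W)
    {ι : Type*} {b : HilbertBasis ι ℝ L2} {ev : ι → ℝ} (hb : IsGraphonEigenbasis W b ev) (i : ι) :
    kernelOp hW (b i) = ev i • b i := by
  refine Lp.ext ?_
  filter_upwards [kernelOp_ae hW (b i), hb i, Lp.coeFn_smul (ev i) (b i)] with u h1 h2 h3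
  rw [h1, h2, h3, Pi.smul_apply, smul_eq_mul]

lemma IsGraphonEigenbasis.mem_Icc {B : ℝ} {W : I → I → ℝ} (hW : IsGraphon B W)
    {ι : Type*} {b : HilbertBasis ι ℝ L2} {ev : ι → ℝ} (hb : IsGraphonEigenbasis W b ev) (i : ι) :
    ev i ∈ Set.Icc (-B) B := by
  have h := ((kernelOp hW).le_opNorm (b i)).trans
    (mul_le_mul_of_nonneg_right (norm_kernelOp_le hW) (norm_nonneg _))
  rw [hb.kernelOp_apply hW, norm_smul, b.orthonormal.1 i, mul_one, mul_one] at h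
  exact abs_le.1 h

/-! ### Cut norm convergence implies strong operator convergence -/

/-- Testing against the sets where `g = ∫_C U(·,v) dv` is nonnegative and where it is negative
bounds `∫ |g|` by twice the cut norm. -/
lemma ofReal_integral_abs_le_cutNorm {U : I → I → ℝ} {M : ℝ}
    (hU : Measurable (Function.uncurry U)) (hM : ∀ u v, |U u v| ≤ M)
    {C : Set I} (hC : MeasurableSet C) :
    ENNReal.ofReal (∫ u, |∫ v in C, U u v|) ≤ 2 * cutNorm U := by
  have hint : Integrable (Function.uncurry U)
      ((volume : Measure I).prod (volume : Measure I)) :=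
    Integrable.of_bound hU.aestronglyMeasurable M (ae_of_all _ fun p => hM p.1 p.2)
  have hg : Measurable fun u => ∫ v in C, U u v :=
    (hU.stronglyMeasurable.integral_prod_right' (ν := volume.restrict C)).measurable
  have hgi : Integrable fun u => ∫ v in C, U u v := by
    refine Integrable.of_bound hg.aestronglyMeasurable (M * (volume : Measure I).real C)
      (ae_of_all _ fun u => ?_)
    exact norm_setIntegral_le_of_norm_le_const (measure_lt_top _ _) fun v _ => hM u v
  have key : ∀ A : Set I, MeasurableSet A →
      ENNReal.ofReal |∫ u in A, ∫ v in C, U u v| ≤ cutNorm U := by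
    intro A hA
    rw [← Real.norm_eq_abs, ofReal_norm,
      show (∫ u in A, ∫ v in C, U u v) =
        ∫ p in A ×ˢ C, U p.1 p.2 ∂((volume : Measure I).prod (volume : Measure I)) from
        (setIntegral_prod (Function.uncurry U) hint.integrableOn).symm]
    exact le_iSup₂_of_le A C (le_iSup₂_of_le hA hC le_rfl)
  set g : I → ℝ := fun u => ∫ v in C, U u v
  have hA : MeasurableSet {u | 0 ≤ g u} := measurableSet_le measurable_const hg
  have hsplit : ∫ u, |g u| ≤ |∫ u in {u | 0 ≤ g u}, g u| + |∫ u in {u | 0 ≤ g u}ᶜ, g u| := by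
    rw [← integral_add_compl hA hgi.abs]
    refine add_le_add ?_ ?_
    · refine le_of_eq_of_le (setIntegral_congr_fun hA fun u hu => ?_) (le_abs_self _)
      exact abs_of_nonneg hu
    · refine le_of_eq_of_le ?_ (neg_le_abs _)
      rw [← integral_neg]
      refine setIntegral_congr_fun hA.compl fun u hu => ?_
      exact abs_of_neg (not_le.1 hu)
  refine (ENNReal.ofReal_le_ofReal hsplit).trans ?_
  rw [ENNReal.ofReal_add (abs_nonneg _) (abs_nonneg _), two_mul]
  exact add_le_add (key _ hA) (key _ hA.compl)

/-- With `g = ∫_C (W' - W)(·,v) dv`, which is bounded by `2B`, this is `∫ g² ≤ 2B ∫ |g|` together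
with the cut norm bound on `∫ |g|`. -/
lemma ofReal_norm_sq_kernelOp_sub_le {B : ℝ} {W W' : I → I → ℝ} (hW : IsGraphon B W)
    (hW' : IsGraphon B W') {C : Set I} (hC : MeasurableSet C) :
    ENNReal.ofReal (‖kernelOp hW' (indicatorConstLp 2 hC (measure_ne_top _ _) 1) -
        kernelOp hW (indicatorConstLp 2 hC (measure_ne_top _ _) 1)‖ ^ 2) ≤
      ENNReal.ofReal (2 * B) * (2 * cutNorm fun u v => W' u v - W u v) := by
  have happ : ∀ {W : I → I → ℝ} (hW : IsGraphon B W),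
      kernelOp hW (indicatorConstLp 2 hC (measure_ne_top _ _) 1) =ᵐ[volume]
        fun u => ∫ v in C, W u v := by
    intro W hW
    filter_upwards [kernelOp_ae hW (indicatorConstLp 2 hC (measure_ne_top _ _) 1)] with u hu
    rw [hu, ← integral_indicator hC]
    refine integral_congr_ae ?_
    filter_upwards [indicatorConstLp_coeFn (p := 2) (hs := hC)
      (hμs := measure_ne_top (volume : Measure I) C) (c := (1 : ℝ))] with v hv
    rw [hv]
    by_cases h : v ∈ C <;> simp [h]
  have hmeas : Measurable (Function.uncurry fun u v => W' u v - W u v) :=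
    hW'.measurable.sub hW.measurable
  have hbound : ∀ u v, |W' u v - W u v| ≤ 2 * B := fun u v =>
    (abs_sub _ _).trans (by linarith [hW'.bound u v, hW.bound u v])
  have hgm : Measurable fun u => ∫ v in C, (W' u v - W u v) :=
    (hmeas.stronglyMeasurable.integral_prod_right' (ν := volume.restrict C)).measurable
  have hgb : ∀ u, |∫ v in C, (W' u v - W u v)| ≤ 2 * B := by
    intro u
    refine (norm_setIntegral_le_of_norm_le_const (f := fun v => W' u v - W u v) (C := 2 * B)
      (measure_lt_top _ _) fun v _ => hbound u v).trans ?_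
    exact mul_le_of_le_one_right (by linarith [hW.nonneg]) measureReal_le_one
  have hWi : ∀ {W : I → I → ℝ} (_ : IsGraphon B W) (u : I), IntegrableOn (W u) C := by
    intro W hW u
    exact Integrable.of_bound hW.measurable.of_uncurry_left.aestronglyMeasurable B
      (ae_of_all _ fun v => hW.bound u v)
  have hsq : ‖kernelOp hW' (indicatorConstLp 2 hC (measure_ne_top _ _) 1) -
        kernelOp hW (indicatorConstLp 2 hC (measure_ne_top _ _) 1)‖ ^ 2 ≤
      2 * B * ∫ u, |∫ v in C, (W' u v - W u v)| := by
    rw [norm_sq_eq_integral, ← integral_const_mul]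
    refine (integral_congr_ae (g := fun u => (∫ v in C, (W' u v - W u v)) ^ 2) ?_).trans_le ?_
    · filter_upwards [happ hW, happ hW', Lp.coeFn_sub
        (kernelOp hW' (indicatorConstLp 2 hC (measure_ne_top _ _) 1))
        (kernelOp hW (indicatorConstLp 2 hC (measure_ne_top _ _) 1))] with u h1 h2 h3
      rw [h3, Pi.sub_apply, h1, h2, integral_sub (hWi hW' u) (hWi hW u)]
    · have hi : Integrable fun u => ∫ v in C, (W' u v - W u v) :=
        Integrable.of_bound hgm.aestronglyMeasurable _ (ae_of_all _ hgb)
      refine integral_mono_of_nonneg (ae_of_all _ fun u => sq_nonneg _)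
        (hi.abs.const_mul _) (ae_of_all _ fun u => ?_)
      simp only
      rw [← sq_abs, pow_two]
      exact mul_le_mul_of_nonneg_right (hgb u) (abs_nonneg _)
  refine (ENNReal.ofReal_le_ofReal hsq).trans ?_
  rw [ENNReal.ofReal_mul (by linarith [hW.nonneg])]
  exact mul_le_mul_right (ofReal_integral_abs_le_cutNorm hmeas hbound hC) _

/-- If uniformly bounded graphons converge in cut norm, their operators converge strongly. -/
theorem tendsto_kernelOp_apply {B : ℝ} {W : I → I → ℝ} (hW : IsGraphon B W)
    {Wn : ℕ → I → I → ℝ} (hWn : ∀ n, IsGraphon B (Wn n))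
    (hcut : Tendsto (fun n => cutNorm fun u v => Wn n u v - W u v) atTop (𝓝 0)) (f : L2) :
    Tendsto (fun n => kernelOp (hWn n) f) atTop (𝓝 (kernelOp hW f)) := by
  refine Lp.induction (by norm_num) (fun f : L2 =>
    Tendsto (fun n => kernelOp (hWn n) f) atTop (𝓝 (kernelOp hW f))) ?_ ?_ ?_ f
  · intro c C hC hμC
    have hind : (Lp.simpleFunc.indicatorConst 2 hC hμC.ne c : L2) =
        c • indicatorConstLp 2 hC (measure_ne_top _ _) (1 : ℝ) := by
      rw [Lp.simpleFunc.coe_indicatorConst]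
      refine Lp.ext ?_
      filter_upwards [indicatorConstLp_coeFn (p := 2) (hs := hC) (hμs := hμC.ne) (c := c),
        indicatorConstLp_coeFn (p := 2) (hs := hC) (hμs := hμC.ne) (c := (1 : ℝ)),
        Lp.coeFn_smul c (indicatorConstLp 2 hC hμC.ne (1 : ℝ))] with u h1 h2 h3
      rw [h1, h3, Pi.smul_apply, h2]
      by_cases h : u ∈ C <;> simp [h]
    rw [hind]
    simp only [map_smul]
    refine Tendsto.const_smul ?_ c
    rw [tendsto_iff_norm_sub_tendsto_zero]
    have h0 : Tendsto (fun n => ENNReal.ofReal (2 * B) *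
        (2 * cutNorm fun u v => Wn n u v - W u v)) atTop (𝓝 0) := by
      have := ENNReal.Tendsto.const_mul (ENNReal.Tendsto.const_mul hcut (a := 2)
        (Or.inr (by norm_num))) (a := ENNReal.ofReal (2 * B)) (Or.inr ENNReal.ofReal_ne_top)
      simpa using this
    have h1 := tendsto_of_tendsto_of_tendsto_of_le_of_le tendsto_const_nhds h0
      (fun n => zero_le) (fun n => ofReal_norm_sq_kernelOp_sub_le hW (hWn n) hC)
    have h2 := (ENNReal.tendsto_toReal ENNReal.zero_ne_top).comp h1
    have h3 := h2.sqrt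
    simpa [Function.comp_def, ENNReal.toReal_ofReal (sq_nonneg _),
      Real.sqrt_sq (norm_nonneg _)] using h3
  · intro f g hf hg _ h1 h2
    simpa only [map_add] using h1.add h2
  · refine Equicontinuous.isClosed_setOfPred_tendsto
      (F := fun n => (kernelOp (hWn n) : L2 → L2)) ?_ (kernelOp hW).continuous
    refine (LipschitzWith.uniformEquicontinuous _ B.toNNReal fun n => ?_).equicontinuous
    refine (kernelOp (hWn n)).lipschitz.weaken ?_
    rw [← NNReal.coe_le_coe, coe_nnnorm, Real.coe_toNNReal _ hW.nonneg]
    exact norm_kernelOp_le _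

/-! ### Step functions on the cells -/

lemma exists_mem_cell {n : ℕ} (hn : 0 < n) (u : I) : ∃ j, u ∈ cell n j := by
  have hn' : (0 : ℝ) < n := by exact_mod_cast hn
  have hu : 0 ≤ (u : ℝ) * n := mul_nonneg u.2.1 hn'.le
  by_cases h : ⌊(u : ℝ) * n⌋₊ < n
  · refine ⟨⟨_, h⟩, ?_, Or.inl ?_⟩
    · rw [div_le_iff₀ hn']; exact Nat.floor_le hu
    · rw [lt_div_iff₀ hn']; exact Nat.lt_floor_add_one _
  · refine ⟨⟨n - 1, by omega⟩, ?_, Or.inr (by simp only; omega)⟩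
    rw [div_le_iff₀ hn']
    have h1 : (n : ℝ) ≤ u * n := (Nat.le_floor_iff hu).1 (not_lt.1 h)
    exact le_trans (by exact_mod_cast n.sub_le 1) h1

lemma eq_of_mem_cell {n : ℕ} {u : I} {j k : Fin n} (hj : u ∈ cell n j) (hk : u ∈ cell n k) :
    j = k := by
  have hn : 0 < n := j.pos
  have hn' : (0 : ℝ) < n := by exact_mod_cast hn
  have key : ∀ {j k : Fin n}, u ∈ cell n j → u ∈ cell n k → ¬ j < k := by
    intro j k hj hk hlt
    have h1 := hk.1
    rcases hj.2 with h | h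
    · have h2 := h1.trans_lt h
      rw [div_lt_div_iff_of_pos_right hn'] at h2
      have : (k : ℕ) < j + 1 := by exact_mod_cast h2
      have : (j : ℕ) < k := hlt
      omega
    · have : (j : ℕ) < k := hlt
      omega
  exact le_antisymm (not_lt.1 (key hk hj)) (not_lt.1 (key hj hk))

lemma measurableSet_cell (n : ℕ) (j : Fin n) : MeasurableSet (cell n j) := by
  refine MeasurableSet.inter (measurableSet_le measurable_const measurable_subtype_coe) ?_
  exact MeasurableSet.union (measurableSet_lt measurable_subtype_coe measurable_const)
    (MeasurableSet.const _)

lemma volume_real_cell (n : ℕ) (j : Fin n) :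
    (volume : Measure I).real (cell n j) = (n : ℝ)⁻¹ := by
  have hn' : (0 : ℝ) < n := by exact_mod_cast j.pos
  have hj : (j : ℝ) + 1 ≤ n := by exact_mod_cast j.2
  have hj0 : (0 : ℝ) ≤ j := Nat.cast_nonneg _
  set a : I := ⟨(j : ℝ) / n, by positivity, by rw [div_le_one hn']; linarith⟩
  set c : I := ⟨((j : ℝ) + 1) / n, by positivity, by rwa [div_le_one hn']⟩
  have hd : (c : ℝ) - a = (n : ℝ)⁻¹ := by
    simp only [a, c]; field_simp; ring
  have hvol : (volume : Measure I) (cell n j) = ENNReal.ofReal ((c : ℝ) - a) := by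
    apply le_antisymm
    · rw [← unitInterval.volume_Icc]
      refine measure_mono fun u hu => ⟨hu.1, ?_⟩
      rcases hu.2 with h | h
      · exact h.le
      · have h' : ((j : ℝ) + 1) = n := by exact_mod_cast h
        change (u : ℝ) ≤ ((j : ℝ) + 1) / n
        rw [h', div_self hn'.ne']
        exact u.2.2
    · rw [← unitInterval.volume_Ioo]
      exact measure_mono fun u hu => ⟨le_of_lt hu.1, Or.inl hu.2⟩
  rw [measureReal_def, hvol, hd, ENNReal.toReal_ofReal (by positivity)]

lemma inducedSignal_of_mem {n : ℕ} (x : Fin n → ℝ) {u : I} {j : Fin n} (hu : u ∈ cell n j) :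
    inducedSignal x u = x j := by
  classical
  rw [inducedSignal, Finset.sum_eq_single j]
  · simp [hu]
  · intro k _ hk
    have : u ∉ cell n k := fun h => hk (eq_of_mem_cell h hu)
    simp [this]
  · simp

lemma inducedGraphon_of_mem {n : ℕ} (S : Matrix (Fin n) (Fin n) ℝ) {u v : I} {j k : Fin n}
    (hu : u ∈ cell n j) (hv : v ∈ cell n k) : inducedGraphon S u v = S j k := by
  classical
  have h : inducedGraphon S u v = inducedSignal (fun j => inducedSignal (fun k => S j k) v) u := by
    simp only [inducedGraphon, inducedSignal, Finset.sum_mul]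
    exact Finset.sum_congr rfl fun _ _ => Finset.sum_congr rfl fun _ _ => by ring
  rw [h, inducedSignal_of_mem _ hu, inducedSignal_of_mem _ hv]

lemma measurable_inducedSignal {n : ℕ} (x : Fin n → ℝ) : Measurable (inducedSignal x) := by
  classical
  refine Finset.measurable_sum _ fun j _ => measurable_const.mul ?_
  exact Measurable.ite (measurableSet_cell n j) measurable_const measurable_const

lemma integral_inducedSignal {n : ℕ} (x : Fin n → ℝ) :
    ∫ u, inducedSignal x u = (n : ℝ)⁻¹ * ∑ j, x j := by
  classical
  have h : ∀ j, (fun u : I => x j * (if u ∈ cell n j then (1 : ℝ) else 0)) =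
      (cell n j).indicator fun _ => x j := by
    intro j; ext u; by_cases hu : u ∈ cell n j <;> simp [hu]
  simp only [inducedSignal]
  rw [integral_finsetSum _ fun j _ => ?_, Finset.mul_sum]
  · refine Finset.sum_congr rfl fun j _ => ?_
    rw [h, integral_indicator_const _ (measurableSet_cell n j), volume_real_cell, smul_eq_mul]
  · rw [h]; exact (integrable_const _).indicator (measurableSet_cell n j)

lemma IsGraphShift.isGraphon {B : ℝ} (hB : 0 ≤ B) {n : ℕ} {S : Matrix (Fin n) (Fin n) ℝ}
    (hS : IsGraphShift B S) : IsGraphon B (inducedGraphon S) := by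
  classical
  rcases n.eq_zero_or_pos with rfl | hn
  · have h0 : inducedGraphon S = fun _ _ => 0 := by ext u v; simp [inducedGraphon]
    rw [h0]
    exact ⟨measurable_const, fun _ _ => rfl, fun _ _ => by simpa using hB⟩
  refine ⟨?_, fun u v => ?_, fun u v => ?_⟩
  · change Measurable fun p : I × I => ∑ j, ∑ k, S j k *
      (if p.1 ∈ cell n j then 1 else 0) * (if p.2 ∈ cell n k then 1 else 0)
    refine Finset.measurable_sum _ fun j _ => Finset.measurable_sum _ fun k _ => ?_
    refine (measurable_const.mul ?_).mul ?_
    · exact Measurable.ite (measurable_fst (measurableSet_cell n j)) measurable_const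
        measurable_const
    · exact Measurable.ite (measurable_snd (measurableSet_cell n k)) measurable_const
        measurable_const
  · obtain ⟨j, hj⟩ := exists_mem_cell hn u
    obtain ⟨k, hk⟩ := exists_mem_cell hn v
    rw [inducedGraphon_of_mem S hj hk, inducedGraphon_of_mem S hk hj, hS.symm.apply]
  · obtain ⟨j, hj⟩ := exists_mem_cell hn u
    obtain ⟨k, hk⟩ := exists_mem_cell hn v
    rw [inducedGraphon_of_mem S hj hk]
    exact hS.bound j k

lemma memLp_inducedSignal {n : ℕ} (x : Fin n → ℝ) :
    MemLp (inducedSignal x) 2 (volume : Measure I) := by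
  classical
  refine MemLp.of_bound (measurable_inducedSignal x).aestronglyMeasurable (∑ j, |x j|)
    (ae_of_all _ fun u => ?_)
  refine (Finset.abs_sum_le_sum_abs _ _).trans (Finset.sum_le_sum fun j _ => ?_)
  by_cases hu : u ∈ cell n j <;> simp [hu]

/-- The induced graphon signal as an element of `L²([0,1])`, linear in the graph signal. -/
noncomputable def inducedL2 (n : ℕ) : (Fin n → ℝ) →ₗ[ℝ] L2 where
  toFun x := (memLp_inducedSignal x).toLp
  map_add' x y := by
    rw [← MemLp.toLp_add]
    refine MemLp.toLp_congr _ _ (ae_of_all _ fun u => ?_)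
    simp only [inducedSignal, Pi.add_apply, add_mul, Finset.sum_add_distrib]
  map_smul' c x := by
    rw [RingHom.id_apply, ← MemLp.toLp_const_smul]
    refine MemLp.toLp_congr _ _ (ae_of_all _ fun u => ?_)
    simp only [inducedSignal, Pi.smul_apply, smul_eq_mul, mul_assoc, Finset.mul_sum]

lemma inducedL2_ae {n : ℕ} (x : Fin n → ℝ) : inducedL2 n x =ᵐ[volume] inducedSignal x :=
  (memLp_inducedSignal x).coeFn_toLp

lemma eLpNorm_inducedSignal_sub {n : ℕ} (x : Fin n → ℝ) (φ : L2) :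
    eLpNorm (fun u => inducedSignal x u - φ u) 2 (volume : Measure I) =
      edist (inducedL2 n x) φ := by
  rw [Lp.edist_def]
  refine eLpNorm_congr_ae ?_
  filter_upwards [inducedL2_ae x] with u hu
  rw [Pi.sub_apply, hu]

lemma norm_sq_inducedL2 {n : ℕ} (x : Fin n → ℝ) :
    ‖inducedL2 n x‖ ^ 2 = (n : ℝ)⁻¹ * ∑ j, x j ^ 2 := by
  rw [norm_sq_eq_integral, ← integral_inducedSignal]
  refine integral_congr_ae ?_
  filter_upwards [inducedL2_ae x] with u hu
  rw [hu]
  rcases n.eq_zero_or_pos with rfl | hn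
  · simp [inducedSignal]
  · obtain ⟨j, hj⟩ := exists_mem_cell hn u
    rw [inducedSignal_of_mem _ hj, inducedSignal_of_mem _ hj]

/-- The operator of the induced graphon acts on step functions as the matrix `S / n`; the factor
`1 / n` is the measure of a cell. -/
lemma kernelOp_inducedL2 {B : ℝ} {n : ℕ} {S : Matrix (Fin n) (Fin n) ℝ}
    (hS : IsGraphon B (inducedGraphon S)) (x : Fin n → ℝ) :
    kernelOp hS (inducedL2 n x) = inducedL2 n ((n : ℝ)⁻¹ • S.mulVec x) := by
  refine Lp.ext ?_
  filter_upwards [kernelOp_ae hS (inducedL2 n x), inducedL2_ae ((n : ℝ)⁻¹ • S.mulVec x)]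
    with u h1 h2
  rw [h1, h2]
  rcases n.eq_zero_or_pos with rfl | hn
  · simp [inducedSignal, inducedGraphon]
  obtain ⟨j, hj⟩ := exists_mem_cell hn u
  rw [inducedSignal_of_mem _ hj, Pi.smul_apply, smul_eq_mul, Matrix.mulVec, dotProduct,
    ← integral_inducedSignal]
  refine integral_congr_ae ?_
  filter_upwards [inducedL2_ae x] with v hv
  obtain ⟨k, hk⟩ := exists_mem_cell hn v
  rw [hv, inducedGraphon_of_mem S hj hk, inducedSignal_of_mem _ hk, inducedSignal_of_mem _ hk]

/-! ### Graph filters -/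

lemma IsEigendecomposition.transpose_mul {n : ℕ} {S V : Matrix (Fin n) (Fin n) ℝ}
    {lam : Fin n → ℝ} (hV : IsEigendecomposition S V lam) : V.transpose * V = 1 :=
  Matrix.mem_orthogonalGroup_iff' (Fin n) ℝ |>.1 hV.1

lemma IsEigendecomposition.mul_transpose {n : ℕ} {S V : Matrix (Fin n) (Fin n) ℝ}
    {lam : Fin n → ℝ} (hV : IsEigendecomposition S V lam) : V * V.transpose = 1 :=
  Matrix.mem_orthogonalGroup_iff (Fin n) ℝ |>.1 hV.1

/-- The `ℓ¹` norm of an eigenvector `v` satisfies `|λ| ∑ |v k| ≤ n B ∑ |v k|`. -/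
lemma IsEigendecomposition.div_mem_Icc {B : ℝ} {n : ℕ} {S V : Matrix (Fin n) (Fin n) ℝ}
    {lam : Fin n → ℝ} (hV : IsEigendecomposition S V lam) (hS : IsGraphShift B S) (i : Fin n) :
    lam i / n ∈ Set.Icc (-B) B := by
  have hn' : (0 : ℝ) < n := by exact_mod_cast i.pos
  have hSV : S * V = V * Matrix.diagonal lam := by
    rw [hV.2, mul_assoc, hV.transpose_mul, mul_one]
  have hent : ∀ k, ∑ j, S k j * V j i = V k i * lam i := by
    intro k
    have := congrFun (congrFun hSV k) i
    rwa [Matrix.mul_diagonal, Matrix.mul_apply] at this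
  have hpos : 0 < ∑ k, |V k i| := by
    have h1 : ∑ k, V k i * V k i = 1 := by
      have := congrFun (congrFun hV.transpose_mul i) i
      simpa [Matrix.mul_apply] using this
    refine lt_of_le_of_ne (Finset.sum_nonneg fun _ _ => abs_nonneg _) fun h0 => ?_
    have hz := (Finset.sum_eq_zero_iff_of_nonneg fun k _ => abs_nonneg (V k i)).1 h0.symm
    have : ∑ k, V k i * V k i = 0 := Finset.sum_eq_zero fun k hk => by
      rw [abs_eq_zero.1 (hz k hk), mul_zero]
    linarith
  have hle : |lam i| * ∑ k, |V k i| ≤ (n * B) * ∑ k, |V k i| := by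
    calc |lam i| * ∑ k, |V k i| = ∑ k, |∑ j, S k j * V j i| := by
          rw [Finset.mul_sum]
          exact Finset.sum_congr rfl fun k _ => by rw [hent, abs_mul, mul_comm]
      _ ≤ ∑ _k : Fin n, B * ∑ j, |V j i| := by
          refine Finset.sum_le_sum fun k _ => (Finset.abs_sum_le_sum_abs _ _).trans ?_
          rw [Finset.mul_sum]
          refine Finset.sum_le_sum fun j _ => ?_
          rw [abs_mul]
          exact mul_le_mul_of_nonneg_right (hS.bound k j) (abs_nonneg _)
      _ = _ := by simp [mul_assoc]
  have h := le_of_mul_le_mul_right hle hpos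
  rw [Set.mem_Icc, ← abs_le, abs_div, abs_of_pos hn', div_le_iff₀ hn']
  linarith

lemma graphFilter_add {n : ℕ} (g₁ g₂ : ℝ → ℝ) (V : Matrix (Fin n) (Fin n) ℝ) (lam : Fin n → ℝ) :
    graphFilter (fun t => g₁ t + g₂ t) V lam = graphFilter g₁ V lam + graphFilter g₂ V lam := by
  simp only [graphFilter, ← Matrix.diagonal_add, mul_add, add_mul]

lemma graphFilter_const {n : ℕ} {S V : Matrix (Fin n) (Fin n) ℝ} {lam : Fin n → ℝ}
    (hV : IsEigendecomposition S V lam) (a : ℝ) :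
    graphFilter (fun _ => a) V lam = a • (1 : Matrix (Fin n) (Fin n) ℝ) := by
  have h : (Matrix.diagonal fun _ => a : Matrix (Fin n) (Fin n) ℝ) = a • 1 := by
    rw [Matrix.smul_one_eq_diagonal]
  rw [graphFilter, h, mul_smul_comm, smul_mul_assoc, mul_one, hV.mul_transpose]

lemma graphFilter_id_mul {n : ℕ} {S V : Matrix (Fin n) (Fin n) ℝ} {lam : Fin n → ℝ}
    (hV : IsEigendecomposition S V lam) (g : ℝ → ℝ) :
    graphFilter (fun t => t * g t) V lam = (n : ℝ)⁻¹ • (S * graphFilter g V lam) := by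
  have h : (Matrix.diagonal fun i => lam i / n * g (lam i / n)) =
      (n : ℝ)⁻¹ • (Matrix.diagonal lam * Matrix.diagonal fun i => g (lam i / n)) := by
    rw [Matrix.diagonal_mul_diagonal, ← Matrix.diagonal_smul]
    congr 1
    ext i
    simp only [Pi.smul_apply, smul_eq_mul]
    ring
  have hS : S * graphFilter g V lam = V * (Matrix.diagonal lam * (V.transpose * V) *
      Matrix.diagonal fun i => g (lam i / n)) * V.transpose := by
    conv_lhs => rw [hV.2]
    simp only [graphFilter, mul_assoc]
  rw [hS, hV.transpose_mul, mul_one, graphFilter, h, mul_smul_comm, smul_mul_assoc]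

/-- An orthogonally diagonalized filter has `ℓ²` operator norm at most the maximum of `|g|` on the
scaled eigenvalues. -/
lemma norm_inducedL2_graphFilter_le {n : ℕ} {S V : Matrix (Fin n) (Fin n) ℝ} {lam : Fin n → ℝ}
    (hV : IsEigendecomposition S V lam) {g : ℝ → ℝ} {c : ℝ} (hc : 0 ≤ c)
    (hg : ∀ i, |g (lam i / n)| ≤ c) (x : Fin n → ℝ) :
    ‖inducedL2 n ((graphFilter g V lam).mulVec x)‖ ≤ c * ‖inducedL2 n x‖ := by
  have hiso : ∀ (U : Matrix (Fin n) (Fin n) ℝ), U.transpose * U = 1 → ∀ y : Fin n → ℝ,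
      ∑ j, (U.mulVec y) j ^ 2 = ∑ j, y j ^ 2 := by
    intro U hU y
    have h1 : U.mulVec y ⬝ᵥ U.mulVec y = y ⬝ᵥ y := by
      rw [Matrix.dotProduct_mulVec, ← Matrix.mulVec_transpose, Matrix.mulVec_mulVec, hU,
        Matrix.one_mulVec]
    simpa [dotProduct, pow_two] using h1
  refine le_of_sq_le_sq ?_ (mul_nonneg hc (norm_nonneg _))
  rw [mul_pow, norm_sq_inducedL2, norm_sq_inducedL2, mul_left_comm]
  refine mul_le_mul_of_nonneg_left ?_ (by positivity)
  rw [graphFilter, ← Matrix.mulVec_mulVec, ← Matrix.mulVec_mulVec, hiso V hV.transpose_mul,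
    ← hiso V.transpose (by rw [Matrix.transpose_transpose, hV.mul_transpose]) x, Finset.mul_sum]
  refine Finset.sum_le_sum fun i _ => ?_
  rw [Matrix.mulVec_diagonal, mul_pow]
  exact mul_le_mul_of_nonneg_right (sq_le_sq' (abs_le.1 (hg i)).1 (abs_le.1 (hg i)).2)
    (sq_nonneg _)

lemma IsEigendecomposition.submatrix {n : ℕ} {S V : Matrix (Fin n) (Fin n) ℝ} {lam : Fin n → ℝ}
    (hV : IsEigendecomposition S V lam) (π : Equiv.Perm (Fin n)) :
    IsEigendecomposition (S.submatrix π π) (V.submatrix π id) lam := by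
  constructor
  · rw [Matrix.mem_orthogonalGroup_iff']
    have : (V.submatrix π id).transpose * V.submatrix π id =
        (V.transpose * V).submatrix id id :=
      Matrix.submatrix_mul_equiv V.transpose V id π id
    rw [this, hV.transpose_mul, Matrix.submatrix_id_id]
  · conv_lhs => rw [hV.2]
    ext i j
    simp [Matrix.mul_apply]

lemma graphFilter_submatrix_mulVec {n : ℕ} (g : ℝ → ℝ) (V : Matrix (Fin n) (Fin n) ℝ)
    (lam : Fin n → ℝ) (x : Fin n → ℝ) (π : Equiv.Perm (Fin n)) :
    (graphFilter g (V.submatrix π id) lam).mulVec (x ∘ π) = (graphFilter g V lam).mulVec x ∘ π := by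
  have h : graphFilter g (V.submatrix π id) lam = (graphFilter g V lam).submatrix π π := by
    ext i j
    simp [graphFilter, Matrix.mul_apply]
  rw [h, Matrix.submatrix_mulVec_equiv]
  simp [Function.comp_assoc]

lemma IsGraphShift.submatrix {B : ℝ} {n : ℕ} {S : Matrix (Fin n) (Fin n) ℝ}
    (hS : IsGraphShift B S) (π : Equiv.Perm (Fin n)) : IsGraphShift B (S.submatrix π π) :=
  ⟨hS.symm.submatrix π, fun _ _ => hS.bound _ _⟩

/-! ### Graphon filters -/

/-- Multiplying the coefficients in an orthonormal basis by numbers of modulus at most `c` gives an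
unconditionally convergent series of norm at most `c ‖φ‖`. -/
lemma summable_and_norm_graphonFilter_le {ι : Type*} {b : HilbertBasis ι ℝ L2} {ev : ι → ℝ}
    {g : ℝ → ℝ} {c : ℝ} (hc : 0 ≤ c) (hg : ∀ i, |g (ev i)| ≤ c) (φ : L2) :
    Summable (graphonFilterTerm g b ev φ) ∧ ‖graphonFilter g b ev φ‖ ≤ c * ‖φ‖ := by
  have hpt : ∀ i, ‖g (ev i) * inner ℝ (b i) φ‖ ≤ ‖(c • b.repr φ) i‖ := by
    intro i
    rw [lp.coeFn_smul, Pi.smul_apply, b.repr_apply_apply, smul_eq_mul, norm_mul, norm_mul]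
    exact mul_le_mul_of_nonneg_right ((hg i).trans (le_abs_self c)) (norm_nonneg _)
  have hmem : Memℓp (fun i => g (ev i) * inner ℝ (b i) φ) 2 :=
    (lp.memℓp (c • b.repr φ)).mono' hpt
  have hsum : HasSum (graphonFilterTerm g b ev φ)
      (b.repr.symm (⟨fun i => g (ev i) * inner ℝ (b i) φ, hmem⟩ : lp (fun _ : ι => ℝ) 2)) :=
    b.hasSum_repr_symm ⟨_, hmem⟩
  refine ⟨hsum.summable, ?_⟩
  rw [graphonFilter, hsum.tsum_eq, LinearIsometryEquiv.norm_map]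
  refine (lp.norm_mono (by norm_num) hpt).trans ?_
  rw [norm_smul, LinearIsometryEquiv.norm_map, Real.norm_of_nonneg hc]

lemma summable_graphonFilterTerm {B : ℝ} {ι : Type*} {b : HilbertBasis ι ℝ L2} {ev : ι → ℝ}
    (hev : ∀ i, ev i ∈ Set.Icc (-B) B) {g : ℝ → ℝ} (hg : ContinuousOn g (Set.Icc (-B) B))
    (φ : L2) : Summable (graphonFilterTerm g b ev φ) := by
  obtain ⟨c, hc⟩ := isCompact_Icc.exists_bound_of_continuousOn hg
  exact (summable_and_norm_graphonFilter_le (le_max_right c 0)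
    (fun i => (hc _ (hev i)).trans (le_max_left c 0)) φ).1

lemma graphonFilter_add {ι : Type*} {b : HilbertBasis ι ℝ L2} {ev : ι → ℝ} {g₁ g₂ : ℝ → ℝ}
    {φ : L2} (h₁ : Summable (graphonFilterTerm g₁ b ev φ))
    (h₂ : Summable (graphonFilterTerm g₂ b ev φ)) :
    graphonFilter (fun t => g₁ t + g₂ t) b ev φ =
      graphonFilter g₁ b ev φ + graphonFilter g₂ b ev φ := by
  rw [graphonFilter, graphonFilter, graphonFilter, ← h₁.tsum_add h₂]
  exact tsum_congr fun i => by simp only [graphonFilterTerm, add_mul, add_smul]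

lemma graphonFilter_const {ι : Type*} (b : HilbertBasis ι ℝ L2) (ev : ι → ℝ) (φ : L2) (a : ℝ) :
    graphonFilter (fun _ => a) b ev φ = a • φ := by
  have h := (b.hasSum_repr φ).const_smul a
  simp only [b.repr_apply_apply, smul_smul] at h
  exact h.tsum_eq

lemma graphonFilter_id_mul {B : ℝ} {W : I → I → ℝ} (hW : IsGraphon B W) {ι : Type*}
    {b : HilbertBasis ι ℝ L2} {ev : ι → ℝ} (hb : IsGraphonEigenbasis W b ev) {g : ℝ → ℝ} {φ : L2}
    (h : Summable (graphonFilterTerm g b ev φ)) :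
    graphonFilter (fun t => t * g t) b ev φ = kernelOp hW (graphonFilter g b ev φ) := by
  rw [graphonFilter, graphonFilter, (kernelOp hW).map_tsum h]
  refine tsum_congr fun i => ?_
  rw [graphonFilterTerm, graphonFilterTerm, map_smul, hb.kernelOp_apply hW, smul_smul]
  congr 1
  ring

/-! ### Convergence of filter outputs -/

/-- Polynomial filters are built from constants by sums and by applying the shift, and each of
these operations preserves convergence. -/
lemma tendsto_inducedL2_polynomial {ι : Type*} {B : ℝ} {W : I → I → ℝ} (hW : IsGraphon B W)
    {φ : L2} {S : ∀ n : ℕ, Matrix (Fin n) (Fin n) ℝ} (hS : ∀ n, IsGraphShift B (S n))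
    {x : ∀ n : ℕ, Fin n → ℝ} {V : ∀ n : ℕ, Matrix (Fin n) (Fin n) ℝ} {lam : ∀ n : ℕ, Fin n → ℝ}
    (hV : ∀ n, IsEigendecomposition (S n) (V n) (lam n)) {b : HilbertBasis ι ℝ L2} {ev : ι → ℝ}
    (hb : IsGraphonEigenbasis W b ev)
    (hcut : Tendsto (fun n => cutNorm fun u v => inducedGraphon (S n) u v - W u v) atTop (𝓝 0))
    (hx : Tendsto (fun n => inducedL2 n (x n)) atTop (𝓝 φ)) (p : Polynomial ℝ) :
    Tendsto (fun n => inducedL2 n ((graphFilter (fun t => p.eval t) (V n) (lam n)).mulVec (x n)))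
      atTop (𝓝 (graphonFilter (fun t => p.eval t) b ev φ)) := by
  have hev := fun i => hb.mem_Icc hW i
  have hGn : ∀ n, IsGraphon B (inducedGraphon (S n)) := fun n => (hS n).isGraphon hW.nonneg
  induction p using Polynomial.induction_on with
  | C a =>
    simp only [Polynomial.eval_C, graphonFilter_const]
    simp_rw [fun n => graphFilter_const (hV n) a, Matrix.smul_mulVec, Matrix.one_mulVec, map_smul]
    exact hx.const_smul a
  | add p q hp hq =>
    simp only [Polynomial.eval_add, graphFilter_add, Matrix.add_mulVec, map_add]
    rw [graphonFilter_add (summable_graphonFilterTerm hev p.continuousOn φ)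
      (summable_graphonFilterTerm hev q.continuousOn φ)]
    exact hp.add hq
  | monomial m a ih =>
    have he : ∀ t : ℝ, (Polynomial.C a * Polynomial.X ^ (m + 1)).eval t =
        t * (Polynomial.C a * Polynomial.X ^ m).eval t := by
      intro t; simp only [Polynomial.eval_mul, Polynomial.eval_C, Polynomial.eval_pow,
        Polynomial.eval_X]; ring
    simp_rw [he]
    rw [graphonFilter_id_mul hW hb
      (summable_graphonFilterTerm hev (Polynomial.continuousOn _) φ)]
    set g : ℝ → ℝ := fun t => (Polynomial.C a * Polynomial.X ^ m).eval t
    have hstep : ∀ n, inducedL2 n ((graphFilter (fun t => t * g t) (V n) (lam n)).mulVec (x n)) =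
        kernelOp (hGn n) (inducedL2 n ((graphFilter g (V n) (lam n)).mulVec (x n))) := by
      intro n
      rw [kernelOp_inducedL2, graphFilter_id_mul (hV n), Matrix.smul_mulVec,
        Matrix.mulVec_mulVec]
    change Tendsto (fun n => inducedL2 n
      ((graphFilter (fun t => t * g t) (V n) (lam n)).mulVec (x n))) atTop _
    simp_rw [hstep]
    have h1 := tendsto_kernelOp_apply hW hGn hcut (graphonFilter g b ev φ)
    rw [tendsto_iff_norm_sub_tendsto_zero] at ih
    have h2 : Tendsto (fun n => kernelOp (hGn n) (inducedL2 n
        ((graphFilter g (V n) (lam n)).mulVec (x n)) - graphonFilter g b ev φ)) atTop (𝓝 0) := by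
      refine squeeze_zero_norm (fun n => ?_) (by simpa using ih.const_mul B)
      exact ((kernelOp (hGn n)).le_opNorm _).trans
        (mul_le_mul_of_nonneg_right (norm_kernelOp_le _) (norm_nonneg _))
    simpa using h2.add h1

/-- For a continuous transfer function, convergence of the outputs follows from the polynomial case,
since on both sides a uniform error `δ` on `[-B, B]` changes the output by at most `δ` times the
norm of the input. -/
theorem tendsto_inducedL2_graphFilter {ι : Type*} {B : ℝ} {W : I → I → ℝ} (hW : IsGraphon B W)
    {φ : L2} {S : ∀ n : ℕ, Matrix (Fin n) (Fin n) ℝ} (hS : ∀ n, IsGraphShift B (S n))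
    {x : ∀ n : ℕ, Fin n → ℝ} {h : ℝ → ℝ} (hh : ContinuousOn h (Set.Icc (-B) B))
    {V : ∀ n : ℕ, Matrix (Fin n) (Fin n) ℝ} {lam : ∀ n : ℕ, Fin n → ℝ}
    (hV : ∀ n, IsEigendecomposition (S n) (V n) (lam n)) {b : HilbertBasis ι ℝ L2} {ev : ι → ℝ}
    (hb : IsGraphonEigenbasis W b ev)
    (hcut : Tendsto (fun n => cutNorm fun u v => inducedGraphon (S n) u v - W u v) atTop (𝓝 0))
    (hx : Tendsto (fun n => inducedL2 n (x n)) atTop (𝓝 φ)) :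
    Tendsto (fun n => inducedL2 n ((graphFilter h (V n) (lam n)).mulVec (x n)))
      atTop (𝓝 (graphonFilter h b ev φ)) := by
  have hev := fun i => hb.mem_Icc hW i
  rw [Metric.tendsto_atTop']
  intro ε hε
  -- `δ` makes the total error `δ (‖φ‖ + 1) + δ + δ ‖φ‖` equal to `ε`.
  set δ : ℝ := ε / (2 * ‖φ‖ + 2) with hδ_def
  have hden : 0 < 2 * ‖φ‖ + 2 := by positivity
  have hδ : 0 < δ := div_pos hε hden
  have hδε : δ * (2 * ‖φ‖ + 2) = ε := div_mul_cancel₀ _ hden.ne'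
  obtain ⟨p, hp⟩ := exists_polynomial_near_of_continuousOn (-B) B h hh δ hδ
  set g : ℝ → ℝ := fun t => p.eval t with hg_def
  set r : ℝ → ℝ := fun t => h t - g t with hr_def
  have hgc : ContinuousOn g (Set.Icc (-B) B) := p.continuousOn
  have hr : ∀ t ∈ Set.Icc (-B) B, |r t| ≤ δ := fun t ht => by
    rw [hr_def, abs_sub_comm]; exact (hp t ht).le
  have hsplit : h = fun t => r t + g t := by ext t; simp [hr_def]
  have hlim : graphonFilter h b ev φ = graphonFilter r b ev φ + graphonFilter g b ev φ := by
    rw [← graphonFilter_add (g₁ := r) (summable_graphonFilterTerm hev (hh.sub hgc) φ)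
      (summable_graphonFilterTerm hev hgc φ), ← hsplit]
  have hfin : ∀ n, inducedL2 n ((graphFilter h (V n) (lam n)).mulVec (x n)) =
      inducedL2 n ((graphFilter r (V n) (lam n)).mulVec (x n)) +
        inducedL2 n ((graphFilter g (V n) (lam n)).mulVec (x n)) := by
    intro n
    conv_lhs => rw [hsplit]
    rw [graphFilter_add, Matrix.add_mulVec, map_add]
  have hpoly := Metric.tendsto_atTop.1
    (tendsto_inducedL2_polynomial hW hS hV hb hcut hx p) δ hδ
  have hbd : ∀ᶠ n in atTop, ‖inducedL2 n (x n)‖ < ‖φ‖ + 1 :=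
    hx.norm.eventually_lt_const (lt_add_one _)
  obtain ⟨N, hN⟩ := hpoly
  obtain ⟨N', hN'⟩ := eventually_atTop.1 hbd
  refine ⟨max N N', fun n hn => ?_⟩
  have h1 := hN n ((le_max_left _ _).trans hn.le)
  have h2 := hN' n ((le_max_right _ _).trans hn.le)
  have h3 := norm_inducedL2_graphFilter_le (hV n) hδ.le
    (fun i => hr _ ((hV n).div_mem_Icc (hS n) i)) (x n)
  have h4 := (summable_and_norm_graphonFilter_le (b := b) hδ.le (fun i => hr _ (hev i)) φ).2
  rw [hfin, hlim]
  refine (dist_add_add_le _ _ _ _).trans_lt ?_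
  have h5 := dist_le_norm_add_norm (inducedL2 n ((graphFilter r (V n) (lam n)).mulVec (x n)))
    (graphonFilter r b ev φ)
  have h6 := mul_le_mul_of_nonneg_left h2.le hδ.le
  linarith

end GraphonSP

theorem mainTheorem1 {ι : Type*} (B : ℝ)
    (W : GraphonSP.I → GraphonSP.I → ℝ) (hW : GraphonSP.IsGraphon B W)
    (φ : GraphonSP.L2)
    (S : ∀ n : ℕ, Matrix (Fin n) (Fin n) ℝ) (hS : ∀ n, GraphonSP.IsGraphShift B (S n))
    (x : ∀ n : ℕ, Fin n → ℝ)
    (h : ℝ → ℝ) (L : ℝ≥0) (hh : LipschitzOnWith L h (Set.Icc (-B) B))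
    (V : ∀ n : ℕ, Matrix (Fin n) (Fin n) ℝ) (lam : ∀ n : ℕ, Fin n → ℝ)
    (hV : ∀ n, GraphonSP.IsEigendecomposition (S n) (V n) (lam n))
    (b : HilbertBasis ι ℝ GraphonSP.L2) (ev : ι → ℝ)
    (hb : GraphonSP.IsGraphonEigenbasis W b ev)
    (hconv : GraphonSP.GraphSignalConverges S x W φ) :
    Summable (GraphonSP.graphonFilterTerm h b ev φ) ∧
      GraphonSP.GraphSignalConverges S
        (fun n => (GraphonSP.graphFilter h (V n) (lam n)).mulVec (x n)) W
        (GraphonSP.graphonFilter h b ev φ) := by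
  refine ⟨GraphonSP.summable_graphonFilterTerm (fun i => hb.mem_Icc hW i) hh.continuousOn φ, ?_⟩
  obtain ⟨π, hcut, hsig⟩ := hconv
  refine ⟨π, hcut, ?_⟩
  simp_rw [GraphonSP.eLpNorm_inducedSignal_sub] at hsig ⊢
  rw [← tendsto_iff_edist_tendsto_0] at hsig ⊢
  -- Filters commute with relabeling, so the permuted graphs may be treated as the given ones.
  simp_rw [← GraphonSP.graphFilter_submatrix_mulVec]
  exact GraphonSP.tendsto_inducedL2_graphFilter hW (fun n => (hS n).submatrix (π n))
    hh.continuousOn (fun n => (hV n).submatrix (π n)) hb hcut hsig
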